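/- Let $p$ be a prime and $n\ge 0$ an integer. Let $\mathbb F_p\text{-mod}$ be the category of finite-dimensional $\mathbb F_p$-vector spaces and $\mathbb Z\text{-free}$ the category of finitely generated free abelian groups. For a functor $F$ from one of these categories to $\mathbb F_p\text{-mod}$, put $F^{(0)}=F$ and define its cross effects by $$F^{(1)}(V|W)=\ker\bigl(F(V\oplus W)\to F(V)\oplus F(W)\bigr),$$ and, for $m\ge 1$, let $F^{(m)}(V|W|V_1|\dots|V_{m-1})$ be the cross effect at $(V|W)$ of the functor $F^{(m-1)}(-|V_1|\dots|V_{m-1})$. The functor $F$ is polynomial of degree at most $n$ if $F(0)=0$ and $F^{(n)}=0$. Let $\mathcal F^n_{\mathbb F_p}$ (respectively $\mathcal A^n_{\mathbb F_p}$) be the category of polynomial functors of degree at most $n$ from $\mathbb F_p\text{-mod}$ (respectively from $\mathbb Z\text{-free}$) to $\mathbb F_p\text{-mod}$, with all natural transformations as morphisms. Precomposition with $\mathbb F_p\otimes_{\mathbb Z}-:\mathbb Z\text{-free}\to\mathbb F_p\text{-mod}$ defines a functor $i_n:\mathcal F^n_{\mathbb F_p}\to\mathcal A^n_{\mathbb F_p}$,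 $i_n(F)=F\circ(\mathbb F_p\otimes_{\mathbb Z}-)$. Then every simple object of $\mathcal A^n_{\mathbb F_p}$ is isomorphic to $F\circ(\mathbb F_p\otimes_{\mathbb Z}-)$ for some simple object $F$ of $\mathcal F^n_{\mathbb F_p}$. Conversely, for an object $F$ of $\mathcal F^n_{\mathbb F_p}$, the functor $F\circ(\mathbb F_p\otimes_{\mathbb Z}-)$ is simple in $\mathcal A^n_{\mathbb F_p}$ if and only if $F$ is simple in $\mathcal F^n_{\mathbb F_p}$. Moreover $i_n$ induces a bijection from the isomorphism classes of simple objects of $\mathcal F^n_{\mathbb F_p}$ to those of $\mathcal A^n_{\mathbb F_p}$; in particular the two categories have the same number of isomorphism classes of simple objects. -/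

import Mathlib

open CategoryTheory CategoryTheory.Limits

noncomputable section

namespace PolyFunctor

universe v₁ v₂ v₃ u₁ u₂ u₃

/-! ### Cross effects -/

set_option linter.unusedSectionVars false

section CrossEffect

variable {C : Type u₁} [Category.{v₁} C] [HasZeroMorphisms C] [HasBinaryBiproducts C]
variable {D : Type u₂} [Category.{v₂} D] [HasZeroMorphisms D] [HasBinaryBiproducts D]

/-- The canonical map `F(V ⊕ W) ⟶ F(V) ⊕ F(W)`, given by the two projections. -/
def toSum (F : C ⥤ D) (V W : C) : F.obj (V ⊞ W) ⟶ F.obj V ⊞ F.obj W :=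
  biprod.lift (F.map biprod.fst) (F.map biprod.snd)

lemma toSum_natural (F : C ⥤ D) {V V' : C} (f : V ⟶ V') (W : C) :
    toSum F V W ≫ biprod.map (F.map f) (𝟙 (F.obj W)) =
      F.map (biprod.map f (𝟙 W)) ≫ toSum F V' W := by
  ext
  · rw [toSum, Category.assoc, biprod.map_fst, biprod.lift_fst_assoc, toSum, Category.assoc,
      biprod.lift_fst, ← F.map_comp, ← F.map_comp, biprod.map_fst]
  · rw [toSum, Category.assoc, biprod.map_snd, biprod.lift_snd_assoc, toSum, Category.assoc,
      biprod.lift_snd, ← F.map_comp, biprod.map_snd, Category.comp_id, Category.comp_id]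

@[simp]
lemma map_id_id (V W : C) : biprod.map (𝟙 V) (𝟙 W) = 𝟙 (V ⊞ W) := by
  ext <;> simp

lemma map_comp_id {U V V' : C} (f : U ⟶ V) (g : V ⟶ V') (W : C) :
    biprod.map (f ≫ g) (𝟙 W) = biprod.map f (𝟙 W) ≫ biprod.map g (𝟙 W) := by
  ext <;> simp

variable [HasKernels D]

/-- The cross effect `F^{(1)}(V | W) = ker (F(V ⊕ W) ⟶ F(V) ⊕ F(W))`,
as a functor of the first variable `V`. -/
def crossEffect (F : C ⥤ D) (W : C) : C ⥤ D where
  obj V := kernel (toSum F V W)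
  map f := kernel.map _ _ (F.map (biprod.map f (𝟙 W))) (biprod.map (F.map f) (𝟙 _))
    (toSum_natural F f W)
  map_id V := by
    rw [← cancel_mono (kernel.ι _)]
    simp [kernel.map]
  map_comp f g := by
    rw [← cancel_mono (kernel.ι _)]
    simp [kernel.map, map_comp_id]

/-- The iterated cross effect. For `L = [W, V_1, …, V_{n-1}]`, of length `n`, this is the functor
`V ↦ F^{(n)}(V | W | V_1 | … | V_{n-1})`: the cross effect, in the first variable, of the
`(n-1)`-st cross effect. For the empty list it is `F` itself. -/
def crossEffects (F : C ⥤ D) : List C → (C ⥤ D)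
  | [] => F
  | W :: L => crossEffect (crossEffects F L) W

/-- `F` is polynomial of degree at most `n`: it is reduced, i.e. `F(0) = 0`, and its `n`-th cross
effect (a functor of `n + 1` variables) vanishes. -/
def IsPolynomial (C : Type u₁) [Category.{v₁} C] [HasZeroMorphisms C] [HasBinaryBiproducts C]
    (D : Type u₂) [Category.{v₂} D] [HasZeroMorphisms D] [HasBinaryBiproducts D] [HasKernels D]
    (n : ℕ) : ObjectProperty (C ⥤ D) := fun F =>
  (∀ Z : C, IsZero Z → IsZero (F.obj Z)) ∧
    ∀ L : List C, L.length = n → ∀ V : C, IsZero ((crossEffects F L).obj V)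

variable {B : Type u₃} [Category.{v₃} B] [HasZeroMorphisms B] [HasBinaryBiproducts B]

/-- The isomorphism `T(V ⊕ W) ≅ T(V) ⊕ T(W)` for a functor `T` preserving direct sums. -/
def sumIso (T : B ⥤ C) [T.PreservesZeroMorphisms] [PreservesBinaryBiproducts T] (V W : B) :
    T.obj (V ⊞ W) ≅ T.obj V ⊞ T.obj W :=
  T.mapBiprod V W

lemma sumIso_fst (T : B ⥤ C) [T.PreservesZeroMorphisms] [PreservesBinaryBiproducts T] (V W : B) :
    (sumIso T V W).hom ≫ biprod.fst = T.map biprod.fst :=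
  biprod.lift_fst _ _

lemma sumIso_snd (T : B ⥤ C) [T.PreservesZeroMorphisms] [PreservesBinaryBiproducts T] (V W : B) :
    (sumIso T V W).hom ≫ biprod.snd = T.map biprod.snd :=
  biprod.lift_snd _ _

lemma sumIso_natural (T : B ⥤ C) [T.PreservesZeroMorphisms] [PreservesBinaryBiproducts T]
    {V V' : B} (f : V ⟶ V') (W : B) :
    T.map (biprod.map f (𝟙 W)) ≫ (sumIso T V' W).hom =
      (sumIso T V W).hom ≫ biprod.map (T.map f) (𝟙 (T.obj W)) := by
  ext
  · rw [Category.assoc, sumIso_fst, ← T.map_comp, biprod.map_fst, Category.assoc,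
      biprod.map_fst, ← Category.assoc, sumIso_fst, T.map_comp]
  · rw [Category.assoc, sumIso_snd, ← T.map_comp, biprod.map_snd, Category.assoc,
      biprod.map_snd, ← Category.assoc, sumIso_snd, T.map_comp, T.map_id]

lemma toSum_comp (T : B ⥤ C) [T.PreservesZeroMorphisms] [PreservesBinaryBiproducts T]
    {G : B ⥤ D} {F : C ⥤ D} (e : G ≅ T ⋙ F) (V W : B) :
    toSum G V W ≫ (biprod.mapIso (e.app V) (e.app W)).hom =
      (e.app (V ⊞ W) ≪≫ F.mapIso (sumIso T V W)).hom ≫ toSum F (T.obj V) (T.obj W) := by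
  ext
  · have h := e.hom.naturality (biprod.fst : V ⊞ W ⟶ V)
    rw [Functor.comp_map, ← sumIso_fst T, F.map_comp] at h
    simpa [toSum] using h
  · have h := e.hom.naturality (biprod.snd : V ⊞ W ⟶ W)
    rw [Functor.comp_map, ← sumIso_snd T, F.map_comp] at h
    simpa [toSum] using h

/-- Cross effects commute with precomposition by a functor preserving direct sums. -/
def crossEffectIso (T : B ⥤ C) [T.PreservesZeroMorphisms] [PreservesBinaryBiproducts T]
    {G : B ⥤ D} {F : C ⥤ D} (e : G ≅ T ⋙ F) (W : B) :
    crossEffect G W ≅ T ⋙ crossEffect F (T.obj W) :=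
  NatIso.ofComponents
    (fun V => kernel.mapIso (toSum G V W) (toSum F (T.obj V) (T.obj W))
      (e.app (V ⊞ W) ≪≫ F.mapIso (sumIso T V W))
      (biprod.mapIso (e.app V) (e.app W)) (toSum_comp T e V W))
    (fun {V V'} f => by
      dsimp only [crossEffect, Functor.comp_obj, Functor.comp_map]
      rw [← cancel_mono (kernel.ι _)]
      have h := congrArg F.map (sumIso_natural T f W)
      rw [F.map_comp, F.map_comp] at h
      simp [kernel.map, h])

/-- The same for the iterated cross effects. -/
def crossEffectsIso (T : B ⥤ C) [T.PreservesZeroMorphisms] [PreservesBinaryBiproducts T]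
    (F : C ⥤ D) : (L : List B) → (crossEffects (T ⋙ F) L ≅ T ⋙ crossEffects F (L.map T.obj))
  | [] => Iso.refl _
  | W :: L => crossEffectIso T (crossEffectsIso T F L) W

lemma IsPolynomial.precomp (T : B ⥤ C) [T.PreservesZeroMorphisms] [PreservesBinaryBiproducts T]
    {F : C ⥤ D} {n : ℕ} (hF : IsPolynomial C D n F) : IsPolynomial B D n (T ⋙ F) :=
  ⟨fun Z hZ => hF.1 _ (T.map_isZero hZ), fun L hL V =>
    (hF.2 (L.map T.obj) (by simpa using hL) (T.obj V)).of_iso ((crossEffectsIso T F L).app V)⟩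

end CrossEffect

/-! ### The categories of polynomial functors -/

section BaseChange

/-- Finitely generated free modules, as a property of `R`-modules. -/
def isFGFree (R : Type) [CommRing R] : ObjectProperty (ModuleCat.{0} R) :=
  fun M => Module.Finite R M ∧ Module.Free R M

/-- The category `R-free` of finitely generated free `R`-modules. -/
abbrev FGFree (R : Type) [CommRing R] : Type 1 := (isFGFree R).FullSubcategory

variable (R : Type) [CommRing R]

instance : (isFGFree R).IsClosedUnderIsomorphisms where
  of_iso e h :=
    haveI := h.1
    haveI := h.2
    ⟨Module.Finite.equiv e.toLinearEquiv, Module.Free.of_equiv e.toLinearEquiv⟩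

instance : (isFGFree R).IsClosedUnderBinaryProducts := by
  refine ObjectProperty.IsClosedUnderLimitsOfShape.mk' ?_
  rintro _ ⟨F, hF⟩
  have h₁ := hF ⟨WalkingPair.left⟩
  have h₂ := hF ⟨WalkingPair.right⟩
  have := h₁.1
  have := h₁.2
  have := h₂.1
  have := h₂.2
  have e := (HasLimit.isoOfNatIso (diagramIsoPair F) ≪≫ (biprod.isoProd _ _).symm ≪≫
    ModuleCat.biprodIsoProd _ _).toLinearEquiv
  exact ⟨Module.Finite.equiv e.symm, Module.Free.of_equiv e.symm⟩

instance : HasBinaryBiproducts (FGFree R) := HasBinaryBiproducts.of_hasBinaryProducts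

variable (A : Type) [CommRing A] [Algebra R A]

/-- The base change functor `A ⊗_R -` from finitely generated free `R`-modules to finitely
generated `A`-modules. -/
def baseChange : FGFree R ⥤ FGModuleCat.{0} A where
  obj M :=
    haveI := M.property.1
    FGModuleCat.of A (TensorProduct R A M.obj)
  map {M N} f :=
    haveI := M.property.1
    haveI := N.property.1
    FGModuleCat.ofHom (LinearMap.baseChange A f.hom.hom)
  map_id M := by
    apply FGModuleCat.hom_ext
    exact LinearMap.baseChange_id
  map_comp f g := by
    apply FGModuleCat.hom_ext
    exact LinearMap.baseChange_comp f.hom.hom g.hom.hom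

instance : (baseChange R A).Additive where
  map_add {M N f g} := by
    apply FGModuleCat.hom_ext
    exact LinearMap.baseChange_add f.hom.hom g.hom.hom

instance : PreservesBinaryBiproducts (baseChange R A) :=
  preservesBinaryBiproducts_of_preservesBiproducts _

end BaseChange

/-- The category `ℤ-free` of finitely generated free abelian groups. -/
abbrev ZFree : Type 1 := FGFree ℤ

variable (p : ℕ) [Fact p.Prime] (n : ℕ)

/-- `𝓕ⁿ`: the category of polynomial functors of degree at most `n` from finite dimensional
`𝔽_p`-vector spaces to finite dimensional `𝔽_p`-vector spaces. -/
abbrev CatF : Type 1 :=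
  (IsPolynomial (FGModuleCat.{0} (ZMod p)) (FGModuleCat.{0} (ZMod p)) n).FullSubcategory

/-- `𝓐ⁿ`: the category of polynomial functors of degree at most `n` from finitely generated free
abelian groups to finite dimensional `𝔽_p`-vector spaces. -/
abbrev CatA : Type 1 :=
  (IsPolynomial ZFree (FGModuleCat.{0} (ZMod p)) n).FullSubcategory

/-- The functor `𝓕ⁿ ⥤ 𝓐ⁿ` sending `F` to `F ∘ (𝔽_p ⊗_ℤ -)`. -/
def precompBaseChange : CatF p n ⥤ CatA p n :=
  ObjectProperty.lift _
    (ObjectProperty.ι _ ⋙ (Functor.whiskeringLeft _ _ _).obj (baseChange ℤ (ZMod p)))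
    (fun F => F.property.precomp (baseChange ℤ (ZMod p)))

/-! ### Isomorphism classes of simple objects -/

/-- The set of isomorphism classes of simple objects of a category. -/
def simpleClasses (C : Type u₁) [Category.{v₁} C] [HasZeroMorphisms C] :
    Set (Quotient (isIsomorphicSetoid C)) :=
  {c | ∃ S : C, Simple S ∧ Quotient.mk (isIsomorphicSetoid C) S = c}

/-- The map on isomorphism classes of objects induced by a functor. -/
def mapClasses {C : Type u₁} [Category.{v₁} C] {D : Type u₂} [Category.{v₂} D] (G : C ⥤ D) :
    Quotient (isIsomorphicSetoid C) → Quotient (isIsomorphicSetoid D) :=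
  Quotient.map G.obj (fun _ _ ⟨e⟩ => ⟨G.mapIso e⟩)

end PolyFunctor

end

/-! The degree condition can be read off on morphisms: a functor F has degree at most n iff it is
reduced and all (n+1)-fold differences of the maps Hom(V, W) → Hom(F V, F W) vanish
(`isPolynomial_iff`).

Let S be a functor on free abelian groups whose (d+1)-fold differences vanish. Its d-fold
differences are additive in each increment and independent of the base point; as p kills all values,
they see the increments only modulo p (`iterDiff_congr`). Hence their images lie in the largest
subfunctor of S that factors through reduction modulo p (`iterDiff_mem_modPPart`). If that
subfunctor is zero, the d-fold differences vanish as well, and descent on d gives S = 0. So a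
nonzero polynomial S has a nonzero such subfunctor, and a simple S is equal to it
(`factorsModP_of_simple`).

Reduction modulo p is full and essentially surjective, so precomposition with it is fully faithful.
Its essential image consists of the functors that factor modulo p and is closed under subobjects, so
simplicity passes both ways and isomorphism classes of simples correspond. -/

noncomputable section

namespace PolyFunctor

universe v₁ v₂ v₃ u₁ u₂ u₃

/-! ### Iterated differences -/

section IteratedDifference

variable {A B : Type*} [AddCommGroup A] [AddCommGroup B]

/-- The iterated difference of a map of abelian groups, along a list of increments. -/
def iterDiff : List A → (A → B) → A → B
  | [], φ => φ
  | h :: L, φ => iterDiff L (fwdDiff h φ)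

lemma fwdDiff_comm (a b : A) (φ : A → B) :
    fwdDiff a (fwdDiff b φ) = fwdDiff b (fwdDiff a φ) := by
  funext x
  simp only [fwdDiff, add_right_comm x a b]
  abel

lemma iterDiff_fwdDiff (L : List A) (h : A) (φ : A → B) :
    iterDiff L (fwdDiff h φ) = fwdDiff h (iterDiff L φ) := by
  induction L generalizing φ with
  | nil => rfl
  | cons a L ih => rw [iterDiff, iterDiff, fwdDiff_comm, ih]

lemma iterDiff_sub (L : List A) (φ ψ : A → B) :
    iterDiff L (φ - ψ) = iterDiff L φ - iterDiff L ψ := by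
  induction L generalizing φ ψ with
  | nil => rfl
  | cons a L ih =>
    have : fwdDiff a (φ - ψ) = fwdDiff a φ - fwdDiff a ψ := by
      funext x; simp only [fwdDiff, Pi.sub_apply]; abel
    rw [iterDiff, this, ih, iterDiff, iterDiff]

lemma iterDiff_const {L : List A} (hL : L ≠ []) (b : B) :
    iterDiff L (fun _ => b) = 0 := by
  induction L with
  | nil => exact absurd rfl hL
  | cons a L ih =>
    rw [iterDiff, iterDiff_fwdDiff]
    rcases L with _ | ⟨c, L⟩
    · funext x; simp [iterDiff, fwdDiff]
    · rw [ih (by simp)]; funext x; simp [fwdDiff]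

variable {A' B' : Type*} [AddCommGroup A'] [AddCommGroup B']

/-- Iterated differences commute with affine changes of the variable and additive changes of the
value. -/
lemma iterDiff_map (L : List A) (φ : A → B) (φ' : A' → B') (u : A →+ A') (c : A') (w : B →+ B')
    (h : ∀ x, w (φ x) = φ' (u x + c)) (x : A) :
    w (iterDiff L φ x) = iterDiff (L.map u) φ' (u x + c) := by
  induction L generalizing φ φ' with
  | nil => exact h x
  | cons a L ih =>
    refine ih _ _ fun y => ?_
    simp only [fwdDiff, map_sub, h, map_add, add_right_comm]

lemma map_iterDiff (L : List A) (φ : A → B) (φ' : A → B') (w : B →+ B')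
    (h : ∀ x, w (φ x) = φ' x) (x : A) : w (iterDiff L φ x) = iterDiff L φ' x := by
  simpa using iterDiff_map L φ φ' (AddMonoidHom.id A) 0 w (by simpa using h) x

/-- If all `(d + 1)`-fold differences of a map vanish and `p` annihilates its values, then its
`d`-fold differences only depend on the increments modulo `p`. -/
lemma iterDiff_congr (p : ℕ) (hp : ∀ b : B, p • b = 0) (φ : A → B) (L L' : List A)
    (hφ : ∀ M : List A, M.length = L.length + 1 → ∀ x, iterDiff M φ x = 0)
    (hL : List.Forall₂ (fun a a' => ∃ k, a' = a + p • k) L L') (x x' : A) :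
    iterDiff L φ x = iterDiff L' φ x' := by
  -- Vanishing second differences make a ↦ ψ(x + a) - ψ(x) additive, so it kills p • k because p
  -- kills B.
  have key : ∀ ψ : A → B, (∀ a b x, fwdDiff a (fwdDiff b ψ) x = 0) →
      ∀ x k, ψ (x + p • k) = ψ x := by
    intro ψ hψ x k
    have hadd : ∀ a b, ψ (x + (a + b)) - ψ x = (ψ (x + a) - ψ x) + (ψ (x + b) - ψ x) := by
      intro a b
      have := hψ a b x
      simp only [fwdDiff, add_assoc] at this
      rw [← sub_eq_zero, ← this]
      abel
    let g : A →+ B := AddMonoidHom.mk' (fun a => ψ (x + a) - ψ x) hadd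
    have h := map_nsmul g p k
    rw [hp] at h
    exact sub_eq_zero.1 h
  have key₁ : ∀ ψ : A → B, (∀ a x, fwdDiff a ψ x = 0) → ∀ x y, ψ x = ψ y := by
    intro ψ hψ x y
    have := hψ (y - x) x
    rw [fwdDiff, add_sub_cancel, sub_eq_zero] at this
    exact this.symm
  suffices h : ∀ x, iterDiff L φ x = iterDiff L' φ x by
    rw [h x]
    refine key₁ _ (fun a y => ?_) _ _
    rw [← iterDiff_fwdDiff]
    exact hφ (a :: L') (by simp [hL.length_eq]) y
  clear x x'
  intro x
  induction hL generalizing φ with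
  | nil => rfl
  | @cons a a' L L' ha hL ih =>
    obtain ⟨k, rfl⟩ := ha
    -- The tail is replaced by induction. Then the head is moved to the outside, where `key` applies
    -- to `iterDiff L' φ`: its second differences are differences of φ of order one above the length
    -- of the full list.
    have h₁ := ih (fwdDiff a φ) (fun M hM y => hφ (a :: M) (by simp [hM]) y)
    rw [iterDiff, iterDiff, h₁, iterDiff_fwdDiff, iterDiff_fwdDiff, fwdDiff, fwdDiff, ← add_assoc,
      key (iterDiff L' φ)]
    intro b c y
    rw [← iterDiff_fwdDiff, ← iterDiff_fwdDiff]
    exact hφ (c :: b :: L') (by simp [hL.length_eq]) y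

end IteratedDifference

/-! ### Polynomial functors in terms of iterated differences -/

section Criterion

variable {C : Type u₁} [Category.{v₁} C] [Preadditive C]
variable {D : Type u₂} [Category.{v₂} D] [Preadditive D]

@[simp]
lemma leftComp_apply {P Q : C} (R : C) (f : P ⟶ Q) (g : Q ⟶ R) :
    Preadditive.leftComp R f g = f ≫ g := rfl

@[simp]
lemma rightComp_apply (P : C) {Q R : C} (g : Q ⟶ R) (f : P ⟶ Q) :
    Preadditive.rightComp P g f = f ≫ g := rfl

/-- All `n`-fold differences of the maps `Hom(V, W) → Hom(F V, F W)` vanish. -/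
def DiffsVanish (n : ℕ) (F : C ⥤ D) : Prop :=
  ∀ (V W : C) (L : List (V ⟶ W)), L.length = n →
    ∀ f, iterDiff L (fun g : V ⟶ W => F.map g) f = 0

variable [HasBinaryBiproducts C] [HasBinaryBiproducts D] [HasKernels D]

/-- The recursion adds the outermost cross effect; peeling off the innermost one instead allows an
induction on n with F varying. -/
lemma crossEffects_append_singleton (F : C ⥤ D) (L : List C) (W : C) :
    crossEffects F (L ++ [W]) = crossEffects (crossEffect F W) L := by
  induction L with
  | nil => rfl
  | cons V L ih => rw [List.cons_append, crossEffects, ih, crossEffects]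

lemma isPolynomial_succ_iff (n : ℕ) (F : C ⥤ D) :
    (∀ L : List C, L.length = n + 1 → ∀ V : C, IsZero ((crossEffects F L).obj V)) ↔
      ∀ W : C, ∀ L : List C, L.length = n →
        ∀ V : C, IsZero ((crossEffects (crossEffect F W) L).obj V) := by
  constructor
  · intro h W L hL V
    rw [← crossEffects_append_singleton]
    exact h _ (by simp [hL]) V
  · intro h L hL V
    obtain ⟨L, W, rfl⟩ : ∃ L' W, L = L' ++ [W] :=
      ⟨L.dropLast, L.getLast (by rintro rfl; simp at hL), (List.dropLast_append_getLast _).symm⟩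
    rw [crossEffects_append_singleton]
    exact h W L (by simpa using hL) V

/-- The inclusion of the cross effect `F^{(1)}(V | W)` into `F(V ⊕ W)`. -/
def crossEffectι (F : C ⥤ D) (V W : C) : (crossEffect F W).obj V ⟶ F.obj (V ⊞ W) :=
  kernel.ι (toSum F V W)

instance (F : C ⥤ D) (V W : C) : Mono (crossEffectι F V W) :=
  inferInstanceAs (Mono (kernel.ι (toSum F V W)))

lemma crossEffect_map_ι (F : C ⥤ D) (W : C) {V V' : C} (f : V ⟶ V') :
    (crossEffect F W).map f ≫ crossEffectι F V' W =
      crossEffectι F V W ≫ F.map (biprod.map f (𝟙 W)) := by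
  simp [crossEffect, kernel.map, crossEffectι]

lemma crossEffectι_toSum (F : C ⥤ D) (V W : C) : crossEffectι F V W ≫ toSum F V W = 0 :=
  kernel.condition _

lemma crossEffectι_fst (F : C ⥤ D) (V W : C) :
    crossEffectι F V W ≫ F.map biprod.fst = 0 := by
  have := crossEffectι_toSum F V W =≫ biprod.fst
  rwa [Category.assoc, toSum, biprod.lift_fst, zero_comp] at this

lemma crossEffectι_snd (F : C ⥤ D) (V W : C) :
    crossEffectι F V W ≫ F.map biprod.snd = 0 := by
  have := crossEffectι_toSum F V W =≫ biprod.snd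
  rwa [Category.assoc, toSum, biprod.lift_snd, zero_comp] at this

/-- The map 0 ⊕ 1 factors through the projection to W, which kills the cross effect. Thus cross
effects are again reduced, and the induction can continue with them. -/
lemma crossEffect_map_zero {F : C ⥤ D} (V V' W : C) :
    (crossEffect F W).map (0 : V ⟶ V') = 0 := by
  rw [← cancel_mono (crossEffectι F V' W), crossEffect_map_ι, zero_comp]
  have : biprod.map (0 : V ⟶ V') (𝟙 W) = biprod.snd ≫ biprod.inr := by
    ext <;> simp
  rw [this, F.map_comp, ← Category.assoc, crossEffectι_snd, zero_comp]

/-- Over a reduced functor `F`, the endomorphism `1 - F(e_V) - F(e_W)` of `F(V ⊕ W)`, where `e_V`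
and `e_W` are the projectors onto the summands, factors through the cross effect. -/
lemma exists_crossEffectProj {F : C ⥤ D} (h0 : ∀ V W : C, F.map (0 : V ⟶ W) = 0) (V W : C) :
    ∃ q : F.obj (V ⊞ W) ⟶ (crossEffect F W).obj V, q ≫ crossEffectι F V W =
      𝟙 _ - F.map (biprod.fst ≫ biprod.inl) - F.map (biprod.snd ≫ biprod.inr) := by
  refine ⟨kernel.lift (toSum F V W) _ ?_, kernel.lift_ι _ _ _⟩
  ext
  · simp only [toSum, Preadditive.sub_comp, Category.assoc, biprod.lift_fst, ← F.map_comp,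
      biprod.inl_fst, biprod.inr_fst, Category.comp_id, comp_zero, h0, zero_comp,
      Category.id_comp, sub_self]
  · simp only [toSum, Preadditive.sub_comp, Category.assoc, biprod.lift_snd, ← F.map_comp,
      biprod.inl_snd, biprod.inr_snd, Category.comp_id, comp_zero, h0, zero_comp, sub_zero,
      Category.id_comp, sub_self]

/-- Since f + g is the diagonal of V followed by f ⊕ 1 and then (1, g), the deviation F(f + g) -
F(f) - F(g) is the cross effect at f between maps that do not depend on f. -/
lemma fwdDiff_map_eq {F : C ⥤ D} {V U : C} {q : F.obj (V ⊞ V) ⟶ (crossEffect F V).obj V}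
    (hq : q ≫ crossEffectι F V V =
      𝟙 _ - F.map (biprod.fst ≫ biprod.inl) - F.map (biprod.snd ≫ biprod.inr)) (f g : V ⟶ U) :
    (F.map (biprod.lift (𝟙 V) (𝟙 V)) ≫ q) ≫ (crossEffect F V).map f ≫
        (crossEffectι F U V ≫ F.map (biprod.desc (𝟙 U) g)) =
      fwdDiff g (fun k : V ⟶ U => F.map k) f - F.map g := by
  rw [← Category.assoc ((crossEffect F V).map f), crossEffect_map_ι, Category.assoc,
    Category.assoc, reassoc_of% hq, ← F.map_comp]
  simp only [Preadditive.sub_comp, Preadditive.comp_sub, Category.id_comp, ← F.map_comp,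
    Category.assoc, fwdDiff]
  have e₁ : biprod.lift (𝟙 V) (𝟙 V) ≫ biprod.map f (𝟙 V) ≫ biprod.desc (𝟙 U) g = f + g := by
    have : biprod.map f (𝟙 V) ≫ biprod.desc (𝟙 U) g = biprod.desc f g := by ext <;> simp
    rw [this, biprod.lift_desc, Category.id_comp, Category.id_comp]
  have e₂ : biprod.lift (𝟙 V) (𝟙 V) ≫ biprod.fst ≫ biprod.inl ≫ biprod.map f (𝟙 V) ≫
      biprod.desc (𝟙 U) g = f := by simp
  have e₃ : biprod.lift (𝟙 V) (𝟙 V) ≫ biprod.snd ≫ biprod.inr ≫ biprod.map f (𝟙 V) ≫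
      biprod.desc (𝟙 U) g = g := by simp
  rw [e₁, e₂, e₃]

/-- By `fwdDiff_map_eq`, the difference along g is an additive image of the cross effect plus the
constant F(g). At least one further difference is taken, so the constant disappears. -/
lemma DiffsVanish.of_crossEffect {F : C ⥤ D} (h0 : ∀ V W : C, F.map (0 : V ⟶ W) = 0) {n : ℕ}
    (h : ∀ W : C, DiffsVanish (n + 1) (crossEffect F W)) : DiffsVanish (n + 2) F := by
  intro V U L hL f
  obtain ⟨g, L, rfl⟩ : ∃ g L', L = g :: L' := List.exists_cons_of_length_eq_add_one hL
  have hL' : L.length = n + 1 := by simpa using hL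
  obtain ⟨q, hq⟩ := exists_crossEffectProj h0 V V
  have h₁ := map_iterDiff L (fun k : V ⟶ U => (crossEffect F V).map k)
    (fwdDiff g (fun k : V ⟶ U => F.map k) - fun _ => F.map g)
    ((Preadditive.leftComp _ (F.map (biprod.lift (𝟙 V) (𝟙 V)) ≫ q)).comp
      (Preadditive.rightComp _ (crossEffectι F U V ≫ F.map (biprod.desc (𝟙 U) g))))
    (fun k => by simpa using fwdDiff_map_eq hq k g) f
  rw [h V V U L hL', map_zero, iterDiff_sub,
    iterDiff_const (by rintro rfl; simp at hL')] at h₁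
  simpa [iterDiff] using h₁.symm

/-- On the cross effect F(f ⊕ 0) vanishes, so F(f ⊕ 1) acts there as the difference of F at f ⊕ 0
along c = 0 ⊕ 1. This uses up one of the n + 2 differences. -/
lemma DiffsVanish.crossEffect {F : C ⥤ D} {n : ℕ} (h : DiffsVanish (n + 2) F) (W : C) :
    DiffsVanish (n + 1) (crossEffect F W) := by
  intro V V' L hL f
  rw [← cancel_mono (crossEffectι F V' W), zero_comp]
  let u : (V ⟶ V') →+ (V ⊞ W ⟶ V' ⊞ W) :=
    (Preadditive.leftComp _ biprod.fst).comp (Preadditive.rightComp _ biprod.inl)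
  let c : V ⊞ W ⟶ V' ⊞ W := biprod.snd ≫ biprod.inr
  let ψ : (V ⊞ W ⟶ V' ⊞ W) → (F.obj (V ⊞ W) ⟶ F.obj (V' ⊞ W)) :=
    fwdDiff c (fun k : V ⊞ W ⟶ V' ⊞ W => F.map k)
  have h₁ := iterDiff_map L (fun k : V ⟶ V' => (PolyFunctor.crossEffect F W).map k)
    (fun k => crossEffectι F V W ≫ ψ k) u 0
    (Preadditive.rightComp _ (crossEffectι F V' W)) (fun k => by
      have e₁ : u k + c = biprod.map k (𝟙 W) := by ext <;> simp [u, c]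
      have e₂ : u k = biprod.fst ≫ k ≫ biprod.inl := by simp [u]
      have e₃ : crossEffectι F V W ≫ F.map (u k) = 0 := by
        rw [e₂, F.map_comp, ← Category.assoc, crossEffectι_fst, zero_comp]
      simp only [add_zero, ψ, fwdDiff, e₁, Preadditive.comp_sub, e₃, sub_zero]
      exact crossEffect_map_ι F W k) f
  have h₂ := map_iterDiff (L.map u) ψ (fun k => crossEffectι F V W ≫ ψ k)
    (Preadditive.leftComp _ (crossEffectι F V W)) (fun k => rfl) (u f + 0)
  have h₃ := h _ _ (c :: L.map u) (by simpa using hL) (u f + 0)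
  rw [show iterDiff (L.map u) ψ (u f + 0) = 0 from h₃, map_zero] at h₂
  exact h₁.trans h₂.symm

lemma diffsVanish_succ_iff {F : C ⥤ D} (h0 : ∀ V W : C, F.map (0 : V ⟶ W) = 0) (n : ℕ) :
    (∀ L : List C, L.length = n → ∀ V : C, IsZero ((crossEffects F L).obj V)) ↔
      DiffsVanish (n + 1) F := by
  induction n generalizing F with
  | zero =>
    constructor
    · intro h V W L hL f
      exact (h [] rfl V).eq_of_src _ _
    · rintro h L hL V
      obtain rfl := List.length_eq_zero_iff.1 hL
      rw [crossEffects, IsZero.iff_id_eq_zero]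
      -- The difference at 0 along the identity is F(1) - F(0) = 1.
      simpa [iterDiff, fwdDiff, h0] using h V V [𝟙 V] rfl 0
  | succ n ih =>
    rw [isPolynomial_succ_iff]
    simp only [ih (fun _ _ => crossEffect_map_zero _ _ _)]
    exact ⟨DiffsVanish.of_crossEffect h0, DiffsVanish.crossEffect⟩

/-- A functor is polynomial of degree at most `n` if and only if it is reduced and its
`(n + 1)`-fold differences vanish. -/
theorem isPolynomial_iff [HasZeroObject C] (n : ℕ) (F : C ⥤ D) :
    IsPolynomial C D n F ↔ (∀ V W : C, F.map (0 : V ⟶ W) = 0) ∧ DiffsVanish (n + 1) F := by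
  have h0 : (∀ Z : C, IsZero Z → IsZero (F.obj Z)) ↔ ∀ V W : C, F.map (0 : V ⟶ W) = 0 := by
    constructor
    · intro h V W
      obtain ⟨Z, hZ⟩ := HasZeroObject.zero (C := C)
      rw [← zero_comp (X := V) (f := (0 : Z ⟶ W)), F.map_comp, (h Z hZ).eq_of_tgt (F.map _) 0,
        zero_comp]
    · intro h Z hZ
      rw [IsZero.iff_id_eq_zero, ← F.map_id, (IsZero.iff_id_eq_zero Z).1 hZ, h]
  rw [IsPolynomial, h0]
  exact and_congr_right fun h => diffsVanish_succ_iff h n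

end Criterion

/-! ### Vanishing differences under subfunctors and precomposition -/

section Transfer

variable {C : Type u₁} [Category.{v₁} C] [Preadditive C]
variable {D : Type u₂} [Category.{v₂} D] [Preadditive D]
variable {B : Type u₃} [Category.{v₃} B] [Preadditive B]

lemma DiffsVanish.of_mono {n : ℕ} {F G : C ⥤ D} (α : F ⟶ G) [∀ V, Mono (α.app V)]
    (h : DiffsVanish n G) : DiffsVanish n F := by
  intro V W L hL f
  rw [← cancel_mono (α.app W), zero_comp]
  have h₁ := map_iterDiff L (fun k : V ⟶ W => F.map k) (fun k => α.app V ≫ G.map k)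
    (Preadditive.rightComp _ (α.app W)) (fun k => α.naturality k) f
  have h₂ := map_iterDiff L (fun k : V ⟶ W => G.map k) (fun k => α.app V ≫ G.map k)
    (Preadditive.leftComp _ (α.app V)) (fun k => rfl) f
  rw [h V W L hL, map_zero] at h₂
  exact h₁.trans h₂.symm

/-- Essential surjectivity moves the source and target into the image of T, and fullness lifts the
base point and every increment. -/
lemma DiffsVanish.of_precomp {n : ℕ} (T : B ⥤ C) [T.Additive] [T.Full] [T.EssSurj] {F : C ⥤ D}
    (h : DiffsVanish n (T ⋙ F)) : DiffsVanish n F := by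
  intro V W L hL f
  let i := T.objObjPreimageIso V
  let j := T.objObjPreimageIso W
  let w : (F.obj V ⟶ F.obj W) →+ (F.obj (T.obj (T.objPreimage V)) ⟶
      F.obj (T.obj (T.objPreimage W))) :=
    (Preadditive.leftComp _ (F.map i.hom)).comp (Preadditive.rightComp _ (F.map j.inv))
  let u : (V ⟶ W) →+ (T.obj (T.objPreimage V) ⟶ T.obj (T.objPreimage W)) :=
    (Preadditive.leftComp _ i.hom).comp (Preadditive.rightComp _ j.inv)
  have h₁ := iterDiff_map L (fun k : V ⟶ W => F.map k) (fun k => F.map k) u 0 w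
    (fun k => by simp [u, w]) f
  obtain ⟨M, hM⟩ : ∃ M : List (T.objPreimage V ⟶ T.objPreimage W),
      M.map (T.mapAddHom) = L.map u :=
    ⟨(L.map u).map T.preimage, by simp [Function.comp_def]⟩
  have h₂ := iterDiff_map M (fun k => (T ⋙ F).map k) (fun k => F.map k) T.mapAddHom 0
    (AddMonoidHom.id _) (fun k => by simp [Functor.mapAddHom]) (T.preimage (u f))
  rw [h _ _ M (by rw [← hL, ← List.length_map (f := u) (as := L), ← hM, List.length_map])] at h₂
  have h₃ : w (iterDiff L (fun k : V ⟶ W => F.map k) f) = 0 := by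
    rw [h₁, ← hM]
    simpa using h₂.symm
  rw [← cancel_epi (F.map i.hom), ← cancel_mono (F.map j.inv)]
  simpa [w] using h₃

end Transfer

/-! ### Factorization through a full and essentially surjective functor -/

section Factor

variable {B : Type u₁} [Category.{v₁} B] {C : Type u₂} [Category.{v₂} C]
variable {D : Type u₃} [Category.{v₃} D]

/-- A functor that identifies all morphisms identified by a full and essentially surjective
functor `T` factors through `T`. -/
lemma exists_comp_iso (T : B ⥤ C) [T.Full] [T.EssSurj] (S : B ⥤ D)
    (hS : ∀ ⦃V W : B⦄ (f g : V ⟶ W), T.map f = T.map g → S.map f = S.map g) :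
    ∃ F : C ⥤ D, Nonempty (T ⋙ F ≅ S) := by
  -- The chosen lifts of morphisms are not functorial in B, but `hS` makes their images under S so.
  let F : C ⥤ D :=
    { obj X := S.obj (T.objPreimage X)
      map {X Y} u := S.map (T.preimage
        ((T.objObjPreimageIso X).hom ≫ u ≫ (T.objObjPreimageIso Y).inv))
      map_id X := by
        rw [← S.map_id]
        exact hS _ _ (by simp)
      map_comp u v := by
        rw [← S.map_comp]
        exact hS _ _ (by simp) }
  refine ⟨F, ⟨NatIso.ofComponents (fun V =>
    { hom := S.map (T.preimage (T.objObjPreimageIso (T.obj V)).hom)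
      inv := S.map (T.preimage (T.objObjPreimageIso (T.obj V)).inv)
      hom_inv_id := by
        rw [← S.map_comp]
        exact (hS _ (𝟙 _) (by simp)).trans (S.map_id _)
      inv_hom_id := by
        rw [← S.map_comp]
        exact (hS _ (𝟙 _) (by simp)).trans (S.map_id _) }) fun f => ?_⟩⟩
  refine ((S.map_comp _ _).symm.trans (hS _ _ ?_)).trans (S.map_comp _ _)
  simp

/-- Precomposition with a full and essentially surjective functor is full. -/
lemma full_whiskeringLeft (T : B ⥤ C) [T.Full] [T.EssSurj] :
    ((Functor.whiskeringLeft B C D).obj T).Full where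
  map_surjective {F G} α := by
    let i := T.objObjPreimageIso
    refine ⟨{ app X := F.map (i X).inv ≫ α.app (T.objPreimage X) ≫ G.map (i X).hom
              naturality X Y u := ?_ }, ?_⟩
    · have h := α.naturality (T.preimage ((i X).hom ≫ u ≫ (i Y).inv))
      simp only [Functor.whiskeringLeft_obj_obj, Functor.comp_map, Functor.map_preimage] at h
      have e : F.map u ≫ F.map (i Y).inv =
          F.map (i X).inv ≫ F.map ((i X).hom ≫ u ≫ (i Y).inv) := by
        rw [← F.map_comp, ← F.map_comp, Iso.inv_hom_id_assoc]
      rw [reassoc_of% e, reassoc_of% h, Category.assoc, Category.assoc, ← G.map_comp,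
        ← G.map_comp]
      simp only [Category.assoc, Iso.inv_hom_id, Category.comp_id]
    · ext V
      have h := α.naturality (T.preimage (i (T.obj V)).hom)
      simp only [Functor.whiskeringLeft_obj_obj, Functor.comp_map, Functor.map_preimage] at h
      rw [Functor.whiskeringLeft_obj_map, Functor.whiskerLeft_app]
      dsimp only
      rw [← h, ← Category.assoc, ← F.map_comp, Iso.inv_hom_id, F.map_id, Category.id_comp]

lemma faithful_whiskeringLeft (T : B ⥤ C) [T.EssSurj] :
    ((Functor.whiskeringLeft B C D).obj T).Faithful where
  map_injective {F G} α β h := by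
    ext X
    have h' := NatTrans.congr_app h (T.objPreimage X)
    simp only [Functor.whiskeringLeft_obj_map, Functor.whiskerLeft_app] at h'
    rw [← cancel_epi (F.map (T.objObjPreimageIso X).hom), α.naturality, β.naturality, h']

end Factor

/-! ### Subfunctors of functors with values in finitely generated modules -/

section Subfunctor

variable {C : Type u₁} [Category.{v₁} C] {k : Type} [Field k]

/-- The subfunctor given by a family of subspaces stable under the functor. -/
def subfunctor (S : C ⥤ FGModuleCat.{0} k) (N : ∀ V, Submodule k (S.obj V))
    (hN : ∀ ⦃V W⦄ (f : V ⟶ W), ∀ x ∈ N V, (S.map f).hom.hom x ∈ N W) :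
    C ⥤ FGModuleCat.{0} k where
  obj V := FGModuleCat.of k (N V)
  map f := FGModuleCat.ofHom ((S.map f).hom.hom.restrict (hN f))
  map_id V := by
    apply FGModuleCat.hom_ext
    refine LinearMap.ext fun x => Subtype.ext ?_
    exact LinearMap.congr_fun (congrArg (fun φ => φ.hom.hom) (S.map_id V)) x.1
  map_comp f g := by
    apply FGModuleCat.hom_ext
    refine LinearMap.ext fun x => Subtype.ext ?_
    exact LinearMap.congr_fun (congrArg (fun φ => φ.hom.hom) (S.map_comp f g)) x.1

/-- The inclusion of a subfunctor. -/
def subfunctorι (S : C ⥤ FGModuleCat.{0} k) (N : ∀ V, Submodule k (S.obj V))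
    (hN : ∀ ⦃V W⦄ (f : V ⟶ W), ∀ x ∈ N V, (S.map f).hom.hom x ∈ N W) :
    subfunctor S N hN ⟶ S where
  app V := FGModuleCat.ofHom (N V).subtype

instance (S : C ⥤ FGModuleCat.{0} k) (N : ∀ V, Submodule k (S.obj V))
    (hN : ∀ ⦃V W⦄ (f : V ⟶ W), ∀ x ∈ N V, (S.map f).hom.hom x ∈ N W) (V : C) :
    Mono ((subfunctorι S N hN).app V) :=
  ConcreteCategory.mono_of_injective _ (N V).injective_subtype

end Subfunctor

/-! ### Subobjects in the categories of polynomial functors -/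

section Polynomial

variable {C : Type u₁} [Category.{v₁} C] [Preadditive C] [HasBinaryBiproducts C]
variable {k : Type} [Field k] {n : ℕ}

lemma mono_of_mono_app {X Y : (IsPolynomial C (FGModuleCat.{0} k) n).FullSubcategory}
    (f : X ⟶ Y) [∀ V, Mono (f.hom.app V)] : Mono f :=
  (ObjectProperty.ι _).mono_of_mono_map (NatTrans.mono_of_mono_app f.hom)

variable [HasZeroObject C]

lemma IsPolynomial.of_mono {F G : C ⥤ FGModuleCat.{0} k} (α : F ⟶ G) [∀ V, Mono (α.app V)]
    (h : IsPolynomial C (FGModuleCat.{0} k) n G) : IsPolynomial C (FGModuleCat.{0} k) n F := by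
  rw [isPolynomial_iff] at h ⊢
  refine ⟨fun V W => ?_, h.2.of_mono α⟩
  rw [← cancel_mono (α.app W), α.naturality, h.1, zero_comp, comp_zero]

/-- The pointwise kernel is a subfunctor of X, hence itself polynomial, so it is an admissible test
object for the monomorphism f. -/
lemma mono_app_of_mono {X Y : (IsPolynomial C (FGModuleCat.{0} k) n).FullSubcategory}
    (f : X ⟶ Y) [Mono f] (V : C) : Mono (f.hom.app V) := by
  refine ConcreteCategory.mono_of_injective _ ?_
  let N : ∀ V, Submodule k (X.obj.obj V) := fun V => LinearMap.ker (f.hom.app V).hom.hom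
  have hN : ∀ ⦃V W⦄ (g : V ⟶ W), ∀ x ∈ N V, (X.obj.map g).hom.hom x ∈ N W := by
    intro V W g x hx
    have h := LinearMap.congr_fun
      (congrArg (fun φ => φ.hom.hom) (f.hom.naturality g)) x
    simp only [FGModuleCat.hom_hom_comp, LinearMap.comp_apply] at h
    rw [LinearMap.mem_ker] at hx ⊢
    rw [h, hx, map_zero]
  let K : (IsPolynomial C (FGModuleCat.{0} k) n).FullSubcategory :=
    ⟨subfunctor X.obj N hN, X.property.of_mono (subfunctorι X.obj N hN)⟩
  let i : K ⟶ X := ObjectProperty.homMk (subfunctorι X.obj N hN)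
  have hi : i = 0 := by
    rw [← cancel_mono f, zero_comp]
    apply ObjectProperty.hom_ext
    refine NatTrans.ext (funext fun V => FGModuleCat.hom_ext (LinearMap.ext fun x => ?_))
    exact x.2
  have hV : (subfunctorι X.obj N hN).app V = 0 :=
    NatTrans.congr_app (congrArg InducedCategory.Hom.hom hi) V
  have hker : N V = ⊥ := by
    rw [eq_bot_iff]
    intro x hx
    exact LinearMap.congr_fun (congrArg (fun φ => φ.hom.hom) hV) ⟨x, hx⟩
  exact LinearMap.ker_eq_bot.1 hker

end Polynomial

/-! ### Base change -/

section BaseChange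

open TensorProduct

variable {R A M N : Type*} [CommRing R] [CommRing A] [Algebra R A]
  [AddCommGroup M] [AddCommGroup N] [Module R M] [Module R N] [Module.Free R M]

/-- Every coordinate of a value of w dies in A, so it is divisible by m. Freeness of M then lets the
quotients be chosen on a basis and extended linearly. -/
lemma exists_eq_nsmul_of_baseChange_eq_zero [Module.Free R N] (m : ℕ)
    (hr : ∀ z, algebraMap R A z = 0 → (m : R) ∣ z) (w : M →ₗ[R] N)
    (hw : w.baseChange A = 0) : ∃ u : M →ₗ[R] N, w = m • u := by
  classical
  let c := Module.Free.chooseBasis R M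
  let b := Module.Free.chooseBasis R N
  have h : ∀ x, ∃ y, w x = m • y := by
    intro x
    have h₁ : ∀ i, ∃ z, b.repr (w x) i = m * z := by
      intro i
      have h₂ : (b.baseChange A).repr ((1 : A) ⊗ₜ[R] w x) i = 0 := by
        rw [← LinearMap.baseChange_tmul, hw]
        simp
      rw [Module.Basis.baseChange_repr_tmul, Algebra.smul_def, mul_one] at h₂
      exact hr _ h₂
    choose z hz using h₁
    refine ⟨∑ i ∈ (b.repr (w x)).support, z i • b i, ?_⟩
    rw [Finset.smul_sum]
    conv_lhs => rw [← b.linearCombination_repr (w x), Finsupp.linearCombination_apply, Finsupp.sum]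
    exact Finset.sum_congr rfl fun i _ => by
      rw [hz, mul_smul, Nat.cast_smul_eq_nsmul]
  choose y hy using h
  refine ⟨c.constr ℕ fun i => y (c i), c.ext fun i => ?_⟩
  rw [LinearMap.smul_apply, c.constr_basis, hy]

lemma baseChange_surjective (hA : Function.Surjective (algebraMap R A)) :
    Function.Surjective (LinearMap.baseChange A : (M →ₗ[R] N) → _) := by
  intro u
  let c := Module.Free.chooseBasis R M
  choose y hy using fun i => TensorProduct.mk_surjective R N A hA (u (1 ⊗ₜ c i))
  refine ⟨c.constr ℕ y, (c.baseChange A).ext fun i => ?_⟩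
  rw [Module.Basis.baseChange_apply, LinearMap.baseChange_tmul, c.constr_basis]
  exact hy i

end BaseChange

/-! ### Reduction modulo p is full and essentially surjective -/

section BaseChangeFunctor

variable (p : ℕ)

instance : (baseChange ℤ (ZMod p)).Full where
  map_surjective {V W} u := by
    have := V.property.2
    obtain ⟨f, hf⟩ := baseChange_surjective (R := ℤ) (A := ZMod p) (M := V.obj) (N := W.obj)
      ZMod.intCast_surjective u.hom.hom
    exact ⟨ObjectProperty.homMk (ModuleCat.ofHom f), FGModuleCat.hom_ext hf⟩

instance [Fact p.Prime] : (baseChange ℤ (ZMod p)).EssSurj where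
  mem_essImage X := by
    let c := Module.finBasis (ZMod p) X
    let V : ZFree := ⟨ModuleCat.of ℤ (Fin (Module.finrank (ZMod p) X) → ℤ),
      inferInstanceAs (Module.Finite ℤ (Fin (Module.finrank (ZMod p) X) → ℤ)),
      inferInstanceAs (Module.Free ℤ (Fin (Module.finrank (ZMod p) X) → ℤ))⟩
    let b := (Pi.basisFun ℤ (Fin (Module.finrank (ZMod p) X))).baseChange (ZMod p)
    exact ⟨V, ⟨(b.equiv c (Equiv.refl _)).toFGModuleCatIso⟩⟩

lemma exists_eq_add_nsmul {V W : ZFree} {f g : V ⟶ W}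
    (h : (baseChange ℤ (ZMod p)).map f = (baseChange ℤ (ZMod p)).map g) :
    ∃ u, g = f + p • u := by
  have := V.property.2
  have := W.property.2
  obtain ⟨u, hu⟩ := exists_eq_nsmul_of_baseChange_eq_zero (R := ℤ) (A := ZMod p) p
    (fun z hz => (ZMod.intCast_zmod_eq_zero_iff_dvd z p).1 hz) (g - f).hom.hom (by
      have h₁ : (baseChange ℤ (ZMod p)).map (g - f) = 0 := by rw [Functor.map_sub, h, sub_self]
      exact congrArg (fun φ => φ.hom.hom) h₁)
  refine ⟨ObjectProperty.homMk (ModuleCat.ofHom u), ?_⟩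
  rw [← sub_eq_iff_eq_add']
  apply ObjectProperty.hom_ext
  apply ModuleCat.hom_ext
  exact hu

instance : HasZeroObject ZFree :=
  ⟨⟨⟨ModuleCat.of ℤ PUnit, inferInstanceAs (Module.Finite ℤ PUnit),
      inferInstanceAs (Module.Free ℤ PUnit)⟩, by
    rw [IsZero.iff_id_eq_zero]
    apply ObjectProperty.hom_ext
    exact (ModuleCat.isZero_of_subsingleton _).eq_of_src _ _⟩⟩

end BaseChangeFunctor

/-! ### Functors that factor through reduction modulo `p` -/

section Reduction

variable {p : ℕ} [Fact p.Prime] {n : ℕ}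

/-- The functor takes the same value on morphisms with the same reduction modulo `p`. -/
def FactorsModP (S : ZFree ⥤ FGModuleCat.{0} (ZMod p)) : Prop :=
  ∀ ⦃V W : ZFree⦄ (f g : V ⟶ W),
    (baseChange ℤ (ZMod p)).map f = (baseChange ℤ (ZMod p)).map g → S.map f = S.map g

lemma FactorsModP.of_mono {S S' : ZFree ⥤ FGModuleCat.{0} (ZMod p)} (α : S ⟶ S')
    [∀ V, Mono (α.app V)] (h : FactorsModP S') : FactorsModP S := by
  intro V W f g hfg
  rw [← cancel_mono (α.app W), α.naturality, α.naturality, h f g hfg]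

lemma FactorsModP.comp (F : FGModuleCat.{0} (ZMod p) ⥤ FGModuleCat.{0} (ZMod p)) :
    FactorsModP (baseChange ℤ (ZMod p) ⋙ F) :=
  fun _ _ _ _ h => congrArg F.map h

/-- The factorization is again polynomial because vanishing differences descend along a full and
essentially surjective additive functor. -/
lemma FactorsModP.exists_iso {S : CatA p n} (h : FactorsModP S.obj) :
    ∃ F : CatF p n, Nonempty ((precompBaseChange p n).obj F ≅ S) := by
  obtain ⟨F, ⟨e⟩⟩ := exists_comp_iso (baseChange ℤ (ZMod p)) S.obj h
  have hp := S.property.of_mono e.hom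
  have hF : IsPolynomial (FGModuleCat.{0} (ZMod p)) (FGModuleCat.{0} (ZMod p)) n F := by
    rw [isPolynomial_iff] at hp ⊢
    refine ⟨fun V W => ?_, hp.2.of_precomp _⟩
    let i := (baseChange ℤ (ZMod p)).objObjPreimageIso V
    let j := (baseChange ℤ (ZMod p)).objObjPreimageIso W
    have h0 := hp.1 ((baseChange ℤ (ZMod p)).objPreimage V) ((baseChange ℤ (ZMod p)).objPreimage W)
    rw [Functor.comp_map, Functor.map_zero] at h0
    have e₀ : (0 : V ⟶ W) = i.inv ≫ 0 ≫ j.hom := by simp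
    rw [e₀, F.map_comp, F.map_comp, h0, zero_comp, comp_zero]
  exact ⟨⟨F, hF⟩, ⟨ObjectProperty.isoMk _ e⟩⟩

instance : (precompBaseChange p n).Full :=
  have := full_whiskeringLeft (D := FGModuleCat.{0} (ZMod p)) (baseChange ℤ (ZMod p))
  inferInstanceAs (ObjectProperty.lift _ _ _).Full

instance : (precompBaseChange p n).Faithful :=
  have := faithful_whiskeringLeft (D := FGModuleCat.{0} (ZMod p)) (baseChange ℤ (ZMod p))
  inferInstanceAs (ObjectProperty.lift _ _ _).Faithful

instance : (precompBaseChange p n).PreservesZeroMorphisms where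
  map_zero _ _ := rfl

instance : (precompBaseChange p n).PreservesMonomorphisms where
  preserves f _ := by
    have : ∀ V, Mono (((precompBaseChange p n).map f).hom.app V) :=
      fun V => mono_app_of_mono f _
    exact mono_of_mono_app _

/-- The values of the largest subfunctor that factors through reduction modulo `p`. -/
def modPPart (S : ZFree ⥤ FGModuleCat.{0} (ZMod p)) (V : ZFree) :
    Submodule (ZMod p) (S.obj V) :=
  ⨅ (W : ZFree) (f : V ⟶ W) (g : V ⟶ W)
    (_ : (baseChange ℤ (ZMod p)).map f = (baseChange ℤ (ZMod p)).map g),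
    LinearMap.ker ((S.map f).hom.hom - (S.map g).hom.hom)

lemma mem_modPPart {S : ZFree ⥤ FGModuleCat.{0} (ZMod p)} {V : ZFree} {x : S.obj V} :
    x ∈ modPPart S V ↔ ∀ (W : ZFree) (f g : V ⟶ W),
      (baseChange ℤ (ZMod p)).map f = (baseChange ℤ (ZMod p)).map g →
        (S.map f).hom.hom x = (S.map g).hom.hom x := by
  simp only [modPPart, Submodule.mem_iInf, LinearMap.mem_ker, LinearMap.sub_apply, sub_eq_zero]

lemma map_mem_modPPart (S : ZFree ⥤ FGModuleCat.{0} (ZMod p)) ⦃V W : ZFree⦄ (f : V ⟶ W)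
    (x : S.obj V) (hx : x ∈ modPPart S V) : (S.map f).hom.hom x ∈ modPPart S W := by
  rw [mem_modPPart] at hx ⊢
  intro U g h hgh
  have := hx U (f ≫ g) (f ≫ h) (by rw [Functor.map_comp, hgh, Functor.map_comp])
  simpa using this

lemma nsmul_hom_eq_zero {X Y : FGModuleCat.{0} (ZMod p)} (f : X ⟶ Y) : p • f = 0 := by
  apply FGModuleCat.hom_ext
  refine LinearMap.ext fun x => ?_
  change p • f.hom.hom x = 0
  rw [← Nat.cast_smul_eq_nsmul (ZMod p), CharP.cast_eq_zero, zero_smul]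

/-- If the `(d + 1)`-fold differences of `S` vanish, then its `d`-fold differences take values in
the largest subfunctor that factors through reduction modulo `p`. -/
lemma iterDiff_mem_modPPart {S : ZFree ⥤ FGModuleCat.{0} (ZMod p)} {d : ℕ}
    (hS : DiffsVanish (d + 1) S) {V W : ZFree} (L : List (V ⟶ W)) (hL : L.length = d)
    (f : V ⟶ W) (x : S.obj V) :
    (iterDiff L (fun k : V ⟶ W => S.map k) f).hom.hom x ∈ modPPart S W := by
  rw [mem_modPPart]
  intro U u v huv
  -- Composing with S(w) gives the d-fold difference with base point and increments composed with w.
  -- Replacing w by a congruent map changes the increments by multiples of p, and the base point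
  -- does not matter.
  have key : ∀ w : W ⟶ U, iterDiff L (fun k : V ⟶ W => S.map k) f ≫ S.map w =
      iterDiff (L.map fun k => k ≫ w) (fun k : V ⟶ U => S.map k) (f ≫ w) := by
    intro w
    have := iterDiff_map L (fun k : V ⟶ W => S.map k) (fun k : V ⟶ U => S.map k)
      (Preadditive.rightComp V w) 0 (Preadditive.rightComp _ (S.map w)) (fun k => by simp) f
    rw [add_zero] at this
    exact this
  obtain ⟨k, rfl⟩ := exists_eq_add_nsmul p huv
  have h : iterDiff L (fun k : V ⟶ W => S.map k) f ≫ S.map u =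
      iterDiff L (fun k : V ⟶ W => S.map k) f ≫ S.map (u + p • k) := by
    rw [key, key]
    refine iterDiff_congr p nsmul_hom_eq_zero _ _ _ (fun M hM x => hS V U M ?_ x) ?_ _ _
    · rw [hM, List.length_map, hL]
    · rw [List.forall₂_map_left_iff, List.forall₂_map_right_iff, List.forall₂_same]
      exact fun a _ => ⟨a ≫ k, by simp⟩
  exact LinearMap.congr_fun (congrArg (fun φ => φ.hom.hom) h) x

/-- A polynomial functor without nonzero subfunctor factoring through reduction modulo `p` is
zero. -/
lemma id_eq_zero_of_modPPart_eq_bot {S : ZFree ⥤ FGModuleCat.{0} (ZMod p)} {d : ℕ}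
    (hS : DiffsVanish d S) (h : ∀ V, modPPart S V = ⊥) (V : ZFree) : 𝟙 (S.obj V) = 0 := by
  induction d with
  -- The 0-fold difference at the identity is S(1) itself.
  | zero => simpa [iterDiff] using hS V V [] rfl (𝟙 V)
  | succ d ih =>
    refine ih fun V W L hL f => ?_
    apply FGModuleCat.hom_ext
    refine LinearMap.ext fun x => ?_
    have := iterDiff_mem_modPPart hS L hL f x
    rwa [h, Submodule.mem_bot] at this

/-- The inclusion of `modPPart` is nonzero, since otherwise S would be zero; by simplicity it is an
isomorphism. -/
lemma factorsModP_of_simple (S : CatA p n) [Simple S] : FactorsModP S.obj := by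
  let ι := subfunctorι S.obj (modPPart S.obj) (map_mem_modPPart S.obj)
  let T : CatA p n := ⟨_, S.property.of_mono ι⟩
  let i : T ⟶ S := ObjectProperty.homMk ι
  have : ∀ V, Mono (i.hom.app V) := fun V => inferInstanceAs (Mono (ι.app V))
  have : Mono i := mono_of_mono_app i
  have hi : i ≠ 0 := by
    intro hi
    have hbot : ∀ V, modPPart S.obj V = ⊥ := by
      intro V
      rw [eq_bot_iff]
      intro x hx
      have hV : ι.app V = 0 := NatTrans.congr_app (congrArg InducedCategory.Hom.hom hi) V
      exact LinearMap.congr_fun (congrArg (fun φ => φ.hom.hom) hV) ⟨x, hx⟩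
    refine id_nonzero S ?_
    apply ObjectProperty.hom_ext
    refine NatTrans.ext (funext fun V => ?_)
    exact id_eq_zero_of_modPPart_eq_bot ((isPolynomial_iff n _).1 S.property).2 hbot V
  have : IsIso i := isIso_of_mono_of_nonzero hi
  have hT : FactorsModP T.obj := by
    intro V W f g hfg
    apply FGModuleCat.hom_ext
    refine LinearMap.ext fun x => Subtype.ext ?_
    exact mem_modPPart.1 x.2 W f g hfg
  exact hT.of_mono (inv i).hom

/-- A subobject of the composite also factors modulo p, so up to isomorphism it comes from some Y;
by fullness its inclusion comes from a map Y → F, a monomorphism by faithfulness, to which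
simplicity of F applies. -/
lemma simple_precompBaseChange (F : CatF p n) [Simple F] :
    Simple ((precompBaseChange p n).obj F) where
  mono_isIso_iff_nonzero {Z} g _ := by
    have : ∀ V, Mono (g.hom.app V) := mono_app_of_mono g
    obtain ⟨Y, ⟨e⟩⟩ := (FactorsModP.of_mono g.hom (FactorsModP.comp F.obj)).exists_iso
    obtain ⟨f, hf⟩ := (precompBaseChange p n).map_surjective (e.hom ≫ g)
    have : Mono ((precompBaseChange p n).map f) := hf ▸ inferInstance
    have : Mono f := (precompBaseChange p n).mono_of_mono_map this
    have h := Simple.mono_isIso_iff_nonzero f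
    rwa [← isIso_iff_of_reflects_iso f (precompBaseChange p n), ne_eq,
      ← (precompBaseChange p n).map_eq_zero_iff, hf, isIso_comp_left_iff,
      Preadditive.IsIso.comp_left_eq_zero] at h

end Reduction

end PolyFunctor

end

/-! ### The main theorem -/

open PolyFunctor in
theorem mainTheorem8 (p : ℕ) [Fact p.Prime] (n : ℕ) :
    (∀ S : CatA p n, Simple S →
      ∃ F : CatF p n, Simple F ∧ Nonempty ((precompBaseChange p n).obj F ≅ S)) ∧
    (∀ F : CatF p n, Simple ((precompBaseChange p n).obj F) ↔ Simple F) ∧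
    Set.BijOn (mapClasses (precompBaseChange p n))
      (simpleClasses (CatF p n)) (simpleClasses (CatA p n)) ∧
    Cardinal.mk (simpleClasses (CatF p n)) = Cardinal.mk (simpleClasses (CatA p n)) := by
  have h₂ : ∀ F : CatF p n, Simple ((precompBaseChange p n).obj F) ↔ Simple F :=
    fun F => ⟨fun _ => (precompBaseChange p n).simple_of_simple_obj F,
      fun _ => simple_precompBaseChange F⟩
  have h₁ : ∀ S : CatA p n, Simple S →
      ∃ F : CatF p n, Simple F ∧ Nonempty ((precompBaseChange p n).obj F ≅ S) := by
    intro S hS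
    obtain ⟨F, ⟨e⟩⟩ := (factorsModP_of_simple S).exists_iso
    exact ⟨F, (h₂ F).1 (Simple.of_iso e), ⟨e⟩⟩
  have h₃ : Set.BijOn (mapClasses (precompBaseChange p n))
      (simpleClasses (CatF p n)) (simpleClasses (CatA p n)) := by
    refine ⟨?_, ?_, ?_⟩
    · rintro _ ⟨F, hF, rfl⟩
      exact ⟨_, (h₂ F).2 hF, rfl⟩
    · rintro _ ⟨F, hF, rfl⟩ _ ⟨G, hG, rfl⟩ h
      obtain ⟨e⟩ := Quotient.exact h
      exact Quotient.sound ⟨(precompBaseChange p n).preimageIso e⟩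
    · rintro _ ⟨S, hS, rfl⟩
      obtain ⟨F, hF, ⟨e⟩⟩ := h₁ S hS
      exact ⟨_, ⟨F, hF, rfl⟩, Quotient.sound ⟨e⟩⟩
  exact ⟨h₁, h₂, h₃, Cardinal.mk_congr h₃.equiv⟩
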